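/- All Hilbert spaces are finite-dimensional and $\log$ is the base-two logarithm. Let $\mathcal N$ be a quantum channel, i.e. a completely positive trace-preserving linear map from operators on $\mathcal H_A$ to operators on $\mathcal H_B$; let $n\ge 1$ be an integer, $R$ a real number and $\alpha\in(1,2]$. Consider any rate-$R$ code for classical communication over $n$ uses of $\mathcal N$: a message set $\mathsf M$ with $|\mathsf M|=2^{nR}$, a density operator (codeword) $\rho_m$ on $\mathcal H_A^{\otimes n}$ for each $m\in\mathsf M$, and a decoding POVM $\{\Lambda_m\}_{m\in\mathsf M}$ on $\mathcal H_B^{\otimes n}$ ($\Lambda_m\ge 0$, $\sum_m\Lambda_m=I$). Its success probability for a uniformly random message is $$p_{\mathrm{succ}}=\frac1{|\mathsf M|}\sum_{m\in\mathsf M}\operatorname{Tr}\{\Lambda_m\,\mathcal N^{\otimes n}(\rho_m)\}.$$ For positive semidefinite $X,Y$ let $\widetilde D_\alpha(X\|Y)=\frac1{\alpha-1}\log\operatorname{Tr}\big\{\big(Y^{\frac{1-\alpha}{2\alpha}}XY^{\frac{1-\alpha}{2\alpha}}\big)^\alpha\big\}$ if $\operatorname{supp}X\subseteq\operatorname{supp}Y$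 (negative powers being taken on the support of $Y$), and $\widetilde D_\alpha(X\|Y)=\infty$ otherwise. For a channel $\mathcal M$, let $$\widetilde\chi_\alpha(\mathcal M)=\sup_{\{p(x),\rho_x\}}\ \inf_{\sigma}\ \widetilde D_\alpha\big(\rho_{XQ}\,\big\|\,\rho_X\otimes\sigma\big),\qquad \rho_{XQ}=\sum_x p(x)\,|x\rangle\langle x|\otimes\mathcal M(\rho_x),\quad \rho_X=\operatorname{Tr}_Q\rho_{XQ},$$ where the supremum is over all finite ensembles of input density operators and the infimum over all density operators $\sigma$ on the output space. Then $\widetilde\chi_\alpha(\mathcal N^{\otimes n})$ is a finite real number and $$p_{\mathrm{succ}}\le 2^{-n\left(\frac{\alpha-1}{\alpha}\right)\left(R-\frac1n\widetilde\chi_\alpha(\mathcal N^{\otimes n})\right)}.$$ -/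

import Mathlib

section ChannelCoding

open scoped ComplexOrder Kronecker

/-- A density operator on the Hilbert space `ℂ^A`: positive semidefinite, of trace one. -/
def IsDensity {A : Type*} [Fintype A] (ρ : Matrix A A ℂ) : Prop :=
  ρ.PosSemidef ∧ ρ.trace = 1

/-- The map `id_K ⊗ N` on operators on `ℂ^K ⊗ ℂ^A`. -/
def idTensor {A B : Type*} (K : Type*)
    (N : Matrix A A ℂ →ₗ[ℂ] Matrix B B ℂ) (X : Matrix (K × A) (K × A) ℂ) :
    Matrix (K × B) (K × B) ℂ :=
  Matrix.of fun u v => N (Matrix.of fun a a' => X (u.1, a) (v.1, a')) u.2 v.2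

/-- Complete positivity: `id_K ⊗ N` is positive for a reference system `K` of any dimension. -/
def IsCompletelyPositive {A B : Type*} (N : Matrix A A ℂ →ₗ[ℂ] Matrix B B ℂ) : Prop :=
  ∀ (k : ℕ) (X : Matrix (Fin k × A) (Fin k × A) ℂ),
    X.PosSemidef → (idTensor (Fin k) N X).PosSemidef

/-- A quantum channel: a completely positive, trace-preserving linear map. -/
structure IsQuantumChannel {A B : Type*} [Fintype A] [Fintype B]
    (N : Matrix A A ℂ →ₗ[ℂ] Matrix B B ℂ) : Prop where
  completelyPositive : IsCompletelyPositive N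
  tracePreserving : ∀ X : Matrix A A ℂ, (N X).trace = X.trace

/-- The tensor power `N^{⊗n}` acting on operators on `(ℂ^A)^{⊗n}`, the latter space being
`ℂ^(Fin n → A)` with the product basis. It is the linear map whose value at the matrix unit
`|a⟩⟨a'| = ⨂ᵢ |aᵢ⟩⟨a'ᵢ|` is `⨂ᵢ N(|aᵢ⟩⟨a'ᵢ|)`. -/
def tensorPower {A B : Type*} [Fintype A] [DecidableEq A]
    (N : Matrix A A ℂ →ₗ[ℂ] Matrix B B ℂ) (n : ℕ) :
    Matrix (Fin n → A) (Fin n → A) ℂ →ₗ[ℂ] Matrix (Fin n → B) (Fin n → B) ℂ where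
  toFun X := Matrix.of fun b b' =>
    ∑ a : Fin n → A, ∑ a' : Fin n → A,
      X a a' * ∏ i, N (Matrix.single (a i) (a' i) 1) (b i) (b' i)
  map_add' X Y := by
    ext b b'
    simp [add_mul, Finset.sum_add_distrib]
  map_smul' c X := by
    ext b b'
    simp [mul_assoc, Finset.mul_sum]

/-- `N^{⊗n}(X₁ ⊗ ⋯ ⊗ Xₙ) = N(X₁) ⊗ ⋯ ⊗ N(Xₙ)`. -/
theorem tensorPower_product {A B : Type*} [Fintype A] [DecidableEq A]
    (N : Matrix A A ℂ →ₗ[ℂ] Matrix B B ℂ) (n : ℕ) (X : Fin n → Matrix A A ℂ) :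
    tensorPower N n (Matrix.of fun a a' => ∏ i, X i (a i) (a' i)) =
      Matrix.of fun b b' => ∏ i, N (X i) (b i) (b' i) := by
  ext b b'
  have h : ∀ i, N (X i) (b i) (b' i) =
      ∑ p : A × A, X i p.1 p.2 * N (Matrix.single p.1 p.2 1) (b i) (b' i) := by
    intro i
    conv_lhs => rw [Matrix.matrix_eq_sum_single (X i)]
    rw [Fintype.sum_prod_type]
    simp only [map_sum, Matrix.sum_apply]
    refine Finset.sum_congr rfl fun a _ => Finset.sum_congr rfl fun a' _ => ?_
    have : Matrix.single a a' (X i a a') = X i a a' • Matrix.single a a' (1 : ℂ) := by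
      simp [Matrix.smul_single]
    rw [this, map_smul]
    simp
  simp only [tensorPower, LinearMap.coe_mk, AddHom.coe_mk, Matrix.of_apply, h,
    Finset.prod_univ_sum, ← Finset.prod_mul_distrib, Fintype.piFinset_univ]
  rw [← Fintype.sum_prod_type' (f := fun (a a' : Fin n → A) =>
    ∏ i, X i (a i) (a' i) * N (Matrix.single (a i) (a' i) 1) (b i) (b' i))]
  exact Fintype.sum_equiv (Equiv.arrowProdEquivProdArrow (Fin n) (fun _ => A) (fun _ => A)).symm
    _ _ fun _ => rfl

/-- The real power `B ^ s` of a positive semidefinite matrix, for an exponent `s ≠ 0`; since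
`(0 : ℝ) ^ s = 0`, negative powers are taken on the support of `B` only. -/
noncomputable def matrixPower {A : Type*} [Fintype A] [DecidableEq A]
    (B : Matrix A A ℂ) (s : ℝ) : Matrix A A ℂ :=
  cfc (fun x : ℝ => x ^ s) B

open Classical in
/-- The sandwiched quasi-relative entropy
`Q̃_α(A‖B) = Tr[(B^{(1-α)/2α} A B^{(1-α)/2α})^α]` if `supp A ⊆ supp B`, and `∞` otherwise.
The support is the orthogonal complement of the kernel, so that `supp A ⊆ supp B` says that
`ker B ⊆ ker A`. -/
noncomputable def sandwichedQuasiEntropy {H : Type*} [Fintype H] [DecidableEq H]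
    (α : ℝ) (A B : Matrix H H ℂ) : ENNReal :=
  if LinearMap.ker B.mulVecLin ≤ LinearMap.ker A.mulVecLin then
    ENNReal.ofReal (matrixPower
      (matrixPower B ((1 - α) / (2 * α)) * A * matrixPower B ((1 - α) / (2 * α))) α).trace.re
  else ⊤

/-- The sandwiched Rényi relative entropy `D̃_α(A‖B) = (α-1)⁻¹ log₂ Q̃_α(A‖B)`. -/
noncomputable def sandwichedRenyi {H : Type*} [Fintype H] [DecidableEq H]
    (α : ℝ) (A B : Matrix H H ℂ) : EReal :=
  ((1 / (α - 1) / Real.log 2 : ℝ) : EReal) * ENNReal.log (sandwichedQuasiEntropy α A B)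

/-- The classical-quantum operator `ρ_{XQ} = ∑ₓ p(x) |x⟩⟨x| ⊗ ρₓ`. -/
noncomputable def cqState {X Q : Type*} [Fintype X] [DecidableEq X]
    (p : X → ℝ) (ρ : X → Matrix Q Q ℂ) : Matrix (X × Q) (X × Q) ℂ :=
  ∑ x, (p x : ℂ) • (Matrix.single x x (1 : ℂ) ⊗ₖ ρ x)

/-- The reduced operator `ρ_X = Tr_Q ρ_{XQ}`. -/
def partialTraceRight {X Q : Type*} [Fintype Q] (ρ : Matrix (X × Q) (X × Q) ℂ) : Matrix X X ℂ :=
  Matrix.of fun x x' => ∑ q, ρ (x, q) (x', q)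

/-- The `α`-Holevo information `min_σ D̃_α(ρ_{XQ} ‖ ρ_X ⊗ σ)` of an ensemble, the infimum being
over all density operators `σ` on `Q`. -/
noncomputable def ensembleAlphaHolevo {X Q : Type*} [Fintype X] [DecidableEq X]
    [Fintype Q] [DecidableEq Q] (α : ℝ) (p : X → ℝ) (ρ : X → Matrix Q Q ℂ) : EReal :=
  ⨅ σ : {σ : Matrix Q Q ℂ // IsDensity σ},
    sandwichedRenyi α (cqState p ρ) (partialTraceRight (cqState p ρ) ⊗ₖ (σ : Matrix Q Q ℂ))

/-- A finite ensemble `{p(x), ρₓ}` of `k` states. -/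
structure Ensemble (A : Type*) [Fintype A] (k : ℕ) where
  prob : Fin k → ℝ
  prob_nonneg : ∀ x, 0 ≤ prob x
  prob_sum : ∑ x, prob x = 1
  state : Fin k → Matrix A A ℂ
  state_density : ∀ x, IsDensity (state x)

/-- The `α`-Holevo information `χ̃_α(N)` of a channel: the supremum over all finite ensembles of
input states of the `α`-Holevo information of the output ensemble. -/
noncomputable def alphaHolevo {A B : Type*} [Fintype A] [Fintype B] [DecidableEq B]
    (α : ℝ) (N : Matrix A A ℂ →ₗ[ℂ] Matrix B B ℂ) : EReal :=
  ⨆ (k : ℕ) (E : Ensemble A k), ensembleAlphaHolevo α E.prob (fun x => N (E.state x))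

/-- A code for sending messages from the set `M` over `n` uses of a channel from `A` to `B`:
a quantum codeword for each message, in general entangled across the `n` inputs, and a decoding
POVM on the `n` outputs. -/
structure ClassicalCode (A B M : Type*) [Fintype A] [Fintype B] [DecidableEq B] [Fintype M]
    (n : ℕ) where
  codeword : M → Matrix (Fin n → A) (Fin n → A) ℂ
  codeword_density : ∀ m, IsDensity (codeword m)
  povm : M → Matrix (Fin n → B) (Fin n → B) ℂ
  povm_pos : ∀ m, (povm m).PosSemidef
  povm_sum : ∑ m, povm m = 1

/-- The rate of the code is `R` if it has exactly `2^{nR}` messages. -/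
def ClassicalCode.HasRate {A B M : Type*} [Fintype A] [Fintype B] [DecidableEq B] [Fintype M]
    {n : ℕ} (_C : ClassicalCode A B M n) (R : ℝ) : Prop :=
  (Fintype.card M : ℝ) = (2 : ℝ) ^ ((n : ℝ) * R)

/-- The success probability `Pr{M̂ = M} = |M|⁻¹ ∑ₘ Tr[Λₘ N^{⊗n}(ρₘ)]` of a code, for a uniformly
random message. -/
noncomputable def ClassicalCode.successProb {A B M : Type*} [Fintype A] [DecidableEq A]
    [Fintype B] [DecidableEq B] [Fintype M] {n : ℕ} (C : ClassicalCode A B M n)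
    (N : Matrix A A ℂ →ₗ[ℂ] Matrix B B ℂ) : ℝ :=
  (1 / (Fintype.card M : ℝ)) * ∑ m, (C.povm m * tensorPower N n (C.codeword m)).trace.re

end ChannelCoding

/-! A code is a hypothesis test. For the uniform ensemble of codewords, the block-diagonal test `⊕ₘ
Λₘ` accepts `ρ_{XQ}` with probability `P = p_succ`, but accepts `ρ_X ⊗ σ` with probability exactly
`1/|M|` for every `σ`, because the `Λₘ` sum to the identity.

For a test `0 ≤ Λ ≤ 1` and `α > 1`, `trace_test_le` gives `Tr ΛA ≤ (Tr ΛB)^((α-1)/α)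
Q̃_α(A‖B)^(1/α)`. To see this, write `A = SXS` with `S = B^((α-1)/2α)` and `X` the sandwiched
operator. Hölder bounds `Tr (SΛS)X`, and the factor of `SΛS` is controlled by Jensen's trace
inequality for the contraction `Λ^(1/2)`. Both inequalities reduce, in a suitable eigenbasis, to
scalar ones via Peierls.

Taking logarithms and the infimum over `σ` yields `α log P + (α-1) log |M| ≤ (α-1) χ̃_α`, which
rearranges to the bound once `|M| = 2^(nR)`.

Finiteness of `χ̃_α`: the maximally mixed `σ` gives an upper bound uniform over ensembles, and the
trivial test on a one-state ensemble gives the lower bound `0`. That `N^{⊗n}` maps states to states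
follows from its Choi matrix and the Schur product theorem. -/

open scoped ComplexOrder Kronecker
open Matrix

/-! ### Matrix powers and trace inequalities. -/

section MatrixInequalities

variable {H K : Type*} [Fintype H] [DecidableEq H]

/-- The spectrum is finite, hence discrete. This settles the continuity conditions of the functional
calculus even for negative powers at `0`. -/
theorem continuousOn_spectrum_real (A : Matrix H H ℂ) (f : ℝ → ℝ) :
    ContinuousOn f (spectrum ℝ A) := by
  have : Finite (spectrum ℝ A) := A.finite_real_spectrum
  rw [continuousOn_iff_continuous_domRestrict]
  fun_prop

theorem Matrix.IsHermitian.cfc_eq_mul_diagonal_mul {A : Matrix H H ℂ} (hA : A.IsHermitian)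
    (f : ℝ → ℝ) :
    cfc f A = (hA.eigenvectorUnitary : Matrix H H ℂ) *
      diagonal (fun i => ((f (hA.eigenvalues i) : ℝ) : ℂ)) *
        (hA.eigenvectorUnitary : Matrix H H ℂ)ᴴ := by
  rw [hA.cfc_eq, IsHermitian.cfc, Unitary.conjStarAlgAut_apply]
  rfl

theorem Matrix.IsHermitian.trace_cfc {A : Matrix H H ℂ} (hA : A.IsHermitian) (f : ℝ → ℝ) :
    (cfc f A).trace = ((∑ i, f (hA.eigenvalues i) : ℝ) : ℂ) := by
  rw [hA.cfc_eq_mul_diagonal_mul, trace_mul_cycle, ← star_eq_conjTranspose,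
    Unitary.coe_star_mul_self]
  simp [trace]

/-- Diagonal entries of `Lᴴ f(A) L` in terms of the eigenvalues of `A`. -/
theorem Matrix.IsHermitian.conj_cfc_apply_diag {A : Matrix H H ℂ} (hA : A.IsHermitian)
    (f : ℝ → ℝ) (L : Matrix H K ℂ) (j : K) :
    (Lᴴ * cfc f A * L) j j = ((∑ k, f (hA.eigenvalues k) *
      Complex.normSq (((hA.eigenvectorUnitary : Matrix H H ℂ)ᴴ * L) k j) : ℝ) : ℂ) := by
  have h : Lᴴ * cfc f A * L = ((hA.eigenvectorUnitary : Matrix H H ℂ)ᴴ * L)ᴴ *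
      diagonal (fun i => ((f (hA.eigenvalues i) : ℝ) : ℂ)) *
        ((hA.eigenvectorUnitary : Matrix H H ℂ)ᴴ * L) := by
    rw [hA.cfc_eq_mul_diagonal_mul, conjTranspose_mul, conjTranspose_conjTranspose]
    simp only [Matrix.mul_assoc]
  rw [h, mul_apply]
  push_cast
  refine Finset.sum_congr rfl fun k _ => ?_
  rw [mul_diagonal, conjTranspose_apply, Complex.normSq_eq_conj_mul_self]
  simp only [RCLike.star_def]
  ring

theorem isHermitian_matrixPower (A : Matrix H H ℂ) (s : ℝ) : (matrixPower A s).IsHermitian :=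
  cfc_predicate _ _

theorem matrixPower_posSemidef {A : Matrix H H ℂ} (hA : A.PosSemidef) (s : ℝ) :
    (matrixPower A s).PosSemidef := by
  rw [matrixPower, hA.1.cfc_eq_mul_diagonal_mul]
  refine PosSemidef.mul_mul_conjTranspose_same (PosSemidef.diagonal fun i => ?_) _
  have := Real.rpow_nonneg (hA.eigenvalues_nonneg i) s
  simpa using this

theorem Matrix.PosSemidef.spectrum_real_nonneg {A : Matrix H H ℂ} (hA : A.PosSemidef) {x : ℝ}
    (hx : x ∈ spectrum ℝ A) : 0 ≤ x := by
  rw [hA.1.spectrum_real_eq_range_eigenvalues] at hx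
  obtain ⟨i, rfl⟩ := hx
  exact hA.eigenvalues_nonneg i

theorem matrixPower_one {A : Matrix H H ℂ} (hA : A.IsHermitian) : matrixPower A 1 = A := by
  simp only [matrixPower, Real.rpow_one]
  exact cfc_id' ℝ A hA.isSelfAdjoint

/-- The exponents must not cancel: on the kernel `0 ^ s * 0 ^ (-s) = 0` for `s ≠ 0`, whereas `0 ^ 0
= 1`. -/
theorem matrixPower_mul {A : Matrix H H ℂ} (hA : A.PosSemidef) {s t : ℝ} (h : s + t ≠ 0) :
    matrixPower A s * matrixPower A t = matrixPower A (s + t) := by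
  rw [matrixPower, matrixPower, matrixPower, ← cfc_mul _ _ _ (continuousOn_spectrum_real A _)
    (continuousOn_spectrum_real A _)]
  exact cfc_congr fun x hx => (Real.rpow_add' (hA.spectrum_real_nonneg hx) h).symm

theorem matrixPower_matrixPower {A : Matrix H H ℂ} (hA : A.PosSemidef) (s t : ℝ) :
    matrixPower (matrixPower A s) t = matrixPower A (s * t) := by
  have hf : ContinuousOn (fun x : ℝ => x ^ t) ((fun x : ℝ => x ^ s) '' spectrum ℝ A) := by
    have := (A.finite_real_spectrum).image (fun x : ℝ => x ^ s)
    exact this.continuousOn _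
  rw [matrixPower, matrixPower, matrixPower,
    ← cfc_comp' (fun x : ℝ => x ^ t) (fun x : ℝ => x ^ s) A hf (continuousOn_spectrum_real A _)
      hA.1.isSelfAdjoint]
  exact cfc_congr fun x hx => (Real.rpow_mul (hA.spectrum_real_nonneg hx) s t).symm

/-- The trace of `f(T Tᴴ)` equals that of `f(Tᴴ T)`. -/
theorem trace_matrixPower_mul_comm {X Y : Matrix H H ℂ} (h1 : (X * Y).IsHermitian)
    (h2 : (Y * X).IsHermitian) (s : ℝ) :
    (matrixPower (X * Y) s).trace = (matrixPower (Y * X) s).trace := by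
  rw [matrixPower, matrixPower, h1.trace_cfc, h2.trace_cfc,
    (h1.eigenvalues_eq_eigenvalues_iff h2).2 (charpoly_mul_comm X Y)]

/-- The Peierls inequality. -/
theorem rpow_conj_apply_le {B : Matrix H H ℂ} (hB : B.PosSemidef) {q : ℝ} (hq : 1 ≤ q)
    (L : Matrix H K ℂ) (j : K) (hL : ((Lᴴ * L) j j).re ≤ 1) :
    ((Lᴴ * B * L) j j).re ^ q ≤ ((Lᴴ * matrixPower B q * L) j j).re := by
  -- Squared coordinates of column `j` of `L` in an eigenbasis of `B`. By `hL` their total mass is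
  -- at most one, so the claim is the power-mean inequality for sub-probability weights.
  set w : H → ℝ := fun k =>
    Complex.normSq (((hB.1.eigenvectorUnitary : Matrix H H ℂ)ᴴ * L) k j) with hw
  have hw0 : ∀ k, 0 ≤ w k := fun k => Complex.normSq_nonneg _
  have hb := hB.eigenvalues_nonneg
  have h1 : ((Lᴴ * B * L) j j).re = ∑ k, w k * hB.1.eigenvalues k := by
    have := hB.1.conj_cfc_apply_diag (fun x => x) L j
    rw [cfc_id' ℝ B hB.1.isSelfAdjoint] at this
    rw [this, Complex.ofReal_re]
    exact Finset.sum_congr rfl fun k _ => mul_comm _ _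
  have h2 : ((Lᴴ * matrixPower B q * L) j j).re = ∑ k, w k * hB.1.eigenvalues k ^ q := by
    rw [matrixPower, hB.1.conj_cfc_apply_diag, Complex.ofReal_re]
    exact Finset.sum_congr rfl fun k _ => mul_comm _ _
  have h3 : ((Lᴴ * L) j j).re = ∑ k, w k := by
    have := hB.1.conj_cfc_apply_diag (fun _ => 1) L j
    rw [cfc_const_one ℝ B hB.1.isSelfAdjoint, Matrix.mul_one] at this
    rw [this, Complex.ofReal_re]
    simp [hw]
  rw [h1, h2]
  rw [h3] at hL
  have hS : 0 ≤ ∑ k, w k * hB.1.eigenvalues k ^ q :=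
    Finset.sum_nonneg fun k _ => mul_nonneg (hw0 k) (Real.rpow_nonneg (hb k) q)
  have hq0 : 0 < q := by linarith
  calc (∑ k, w k * hB.1.eigenvalues k) ^ q
      ≤ ((∑ k, w k) ^ (1 - q⁻¹) * (∑ k, w k * hB.1.eigenvalues k ^ q) ^ q⁻¹) ^ q :=
        Real.rpow_le_rpow (Finset.sum_nonneg fun k _ => mul_nonneg (hw0 k) (hb k))
          (Real.inner_le_weight_mul_Lp_of_nonneg Finset.univ hq w _ hw0 hb) hq0.le
    _ ≤ (1 * (∑ k, w k * hB.1.eigenvalues k ^ q) ^ q⁻¹) ^ q := by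
        have h0 : 0 ≤ ∑ k, w k := Finset.sum_nonneg fun k _ => hw0 k
        have : (∑ k, w k) ^ (1 - q⁻¹) ≤ 1 :=
          Real.rpow_le_one h0 hL (sub_nonneg.2 (inv_le_one_of_one_le₀ hq))
        gcongr
    _ = ∑ k, w k * hB.1.eigenvalues k ^ q := by
        rw [one_mul, ← Real.rpow_mul hS, inv_mul_cancel₀ hq0.ne', Real.rpow_one]

theorem Matrix.PosSemidef.re_apply_diag_nonneg {H : Type*} {A : Matrix H H ℂ} (hA : A.PosSemidef) (j : H) :
    0 ≤ (A j j).re :=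
  (Complex.le_def.1 (hA.diag_nonneg (i := j))).1

theorem Matrix.IsHermitian.conj_eigenvectorUnitary_apply {A : Matrix H H ℂ} (hA : A.IsHermitian)
    (j : H) : (((hA.eigenvectorUnitary : Matrix H H ℂ)ᴴ * A *
      (hA.eigenvectorUnitary : Matrix H H ℂ)) j j).re = hA.eigenvalues j := by
  have h := hA.conjStarAlgAut_star_eigenvectorUnitary
  rw [Unitary.conjStarAlgAut_star_apply, star_eq_conjTranspose] at h
  rw [h]
  simp

theorem trace_conj_eigenvectorUnitary {A : Matrix H H ℂ} (hA : A.IsHermitian) (Y : Matrix H H ℂ) :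
    ((hA.eigenvectorUnitary : Matrix H H ℂ)ᴴ * Y *
      (hA.eigenvectorUnitary : Matrix H H ℂ)).trace = Y.trace := by
  rw [trace_mul_cycle, ← star_eq_conjTranspose, Unitary.mul_star_self_of_mem (SetLike.coe_mem _),
    Matrix.one_mul]

theorem eigenvectorUnitary_conjTranspose_mul {A : Matrix H H ℂ} (hA : A.IsHermitian) :
    (hA.eigenvectorUnitary : Matrix H H ℂ)ᴴ * (hA.eigenvectorUnitary : Matrix H H ℂ) = 1 := by
  rw [← star_eq_conjTranspose, Unitary.coe_star_mul_self]

/-- Hölder's inequality for the trace. -/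
theorem trace_mul_le_holder {X Y : Matrix H H ℂ} (hX : X.PosSemidef) (hY : Y.PosSemidef)
    {p q : ℝ} (hpq : p.HolderConjugate q) :
    (X * Y).trace.re ≤ (matrixPower X p).trace.re ^ (1 / p) *
      (matrixPower Y q).trace.re ^ (1 / q) := by
  set U : Matrix H H ℂ := ↑hX.1.eigenvectorUnitary with hU
  -- In an eigenbasis of `X` only the diagonal of `Y` enters `Tr XY`. Scalar Hölder then applies,
  -- and Peierls bounds `∑ z ^ q` by `Tr Y ^ q`.
  set z : H → ℝ := fun j => ((Uᴴ * Y * U) j j).re with hz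
  have hz0 : ∀ j, 0 ≤ z j := fun j => (hY.conjTranspose_mul_mul_same U).re_apply_diag_nonneg j
  have h1 : (X * Y).trace.re = ∑ j, hX.1.eigenvalues j * z j := by
    have hX' : X = U * diagonal (fun i => ((hX.1.eigenvalues i : ℝ) : ℂ)) * Uᴴ := by
      have := hX.1.cfc_eq_mul_diagonal_mul (fun x => x)
      rwa [cfc_id' ℝ X hX.1.isSelfAdjoint] at this
    have : (X * Y).trace =
        (diagonal (fun i => ((hX.1.eigenvalues i : ℝ) : ℂ)) * (Uᴴ * Y * U)).trace := by
      conv_lhs => rw [hX']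
      rw [Matrix.mul_assoc, Matrix.mul_assoc, trace_mul_comm]
      simp only [Matrix.mul_assoc]
    rw [this, trace, Complex.re_sum]
    refine Finset.sum_congr rfl fun j _ => ?_
    rw [diag_apply, diagonal_mul, Complex.re_ofReal_mul]
  have h2 : (matrixPower X p).trace.re = ∑ j, hX.1.eigenvalues j ^ p := by
    rw [matrixPower, hX.1.trace_cfc, Complex.ofReal_re]
  have h3 : ∑ j, z j ^ q ≤ (matrixPower Y q).trace.re := by
    rw [← trace_conj_eigenvectorUnitary hX.1 (matrixPower Y q), trace, Complex.re_sum]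
    refine Finset.sum_le_sum fun j _ => rpow_conj_apply_le hY hpq.symm.lt.le U j ?_
    rw [hU, eigenvectorUnitary_conjTranspose_mul]
    simp
  rw [h1, h2]
  refine (Real.inner_le_Lp_mul_Lq_of_nonneg Finset.univ hpq
    (fun j _ => hX.eigenvalues_nonneg j) (fun j _ => hz0 j)).trans ?_
  have h4 : 0 ≤ ∑ j, z j ^ q := Finset.sum_nonneg fun j _ => Real.rpow_nonneg (hz0 j) q
  have h5 : 0 ≤ ∑ j, hX.1.eigenvalues j ^ p :=
    Finset.sum_nonneg fun j _ => Real.rpow_nonneg (hX.eigenvalues_nonneg j) p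
  have h6 := hpq.symm.nonneg
  gcongr

/-- Jensen's trace inequality for a power `q ≥ 1` and a contraction. -/
theorem trace_matrixPower_conj_le [Fintype K] [DecidableEq K] {B : Matrix H H ℂ} (hB : B.PosSemidef) {q : ℝ} (hq : 1 ≤ q)
    (T : Matrix K H ℂ) (hT : (1 - T * Tᴴ).PosSemidef) :
    (matrixPower (T * B * Tᴴ) q).trace.re ≤ (T * matrixPower B q * Tᴴ).trace.re := by
  have hZ := hB.mul_mul_conjTranspose_same T
  set U : Matrix K K ℂ := ↑hZ.1.eigenvectorUnitary with hU
  rw [matrixPower, hZ.1.trace_cfc, Complex.ofReal_re,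
    ← trace_conj_eigenvectorUnitary hZ.1 (T * matrixPower B q * Tᴴ), trace, Complex.re_sum]
  refine Finset.sum_le_sum fun j _ => ?_
  rw [← hZ.1.conj_eigenvectorUnitary_apply j]
  have e : ∀ M : Matrix H H ℂ, Uᴴ * (T * M * Tᴴ) * U = (Tᴴ * U)ᴴ * M * (Tᴴ * U) := fun M => by
    simp only [conjTranspose_mul, conjTranspose_conjTranspose, Matrix.mul_assoc]
  rw [← hU, diag_apply, e, e]
  -- Since `T Tᴴ ≤ 1`, every column of `Tᴴ U` has norm at most one.
  refine rpow_conj_apply_le hB hq (Tᴴ * U) j ?_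
  have h1 := (hT.conjTranspose_mul_mul_same U).re_apply_diag_nonneg j
  have e2 : Uᴴ * (1 - T * Tᴴ) * U = 1 - (Tᴴ * U)ᴴ * (Tᴴ * U) := by
    rw [Matrix.mul_sub, Matrix.sub_mul, Matrix.mul_one, hU,
      eigenvectorUnitary_conjTranspose_mul]
    simp only [conjTranspose_mul, conjTranspose_conjTranspose, Matrix.mul_assoc]
  rw [e2, Matrix.sub_apply, one_apply_eq, Complex.sub_re, Complex.one_re] at h1
  linarith

/-- If `ker B ⊆ ker A` then conjugation by `B ^ s` undoes conjugation by `B ^ (-s)`. -/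
theorem matrixPower_conj_conj {A B : Matrix H H ℂ} (hA : A.IsHermitian) (hB : B.PosSemidef)
    (h : LinearMap.ker B.mulVecLin ≤ LinearMap.ker A.mulVecLin) (s : ℝ) :
    matrixPower B s * (matrixPower B (-s) * A * matrixPower B (-s)) * matrixPower B s = A := by
  -- For `s ≠ 0` this is the projection onto the support of `B`; all that is needed is `B P = B`,
  -- which also holds for `s = 0`.
  set P : Matrix H H ℂ := matrixPower B (-s) * matrixPower B s with hP
  have hPP : matrixPower B s * matrixPower B (-s) = P := by
    rw [hP, matrixPower, matrixPower]
    exact cfc_commute_cfc _ _ _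
  have hBP : B * P = B := by
    have h1 : B = cfc (fun x : ℝ => x) B := (cfc_id' ℝ B hB.1.isSelfAdjoint).symm
    rw [hP, matrixPower, matrixPower, ← cfc_mul _ _ _ (continuousOn_spectrum_real B _)
      (continuousOn_spectrum_real B _)]
    conv_lhs => enter [1]; rw [h1]
    rw [← cfc_mul _ _ _ (continuousOn_spectrum_real B _) (continuousOn_spectrum_real B _)]
    conv_rhs => rw [h1]
    refine cfc_congr fun x hx => ?_
    rcases (hB.spectrum_real_nonneg hx).eq_or_lt with h0 | h0
    · simp [← h0]
    · rw [← Real.rpow_add h0, neg_add_cancel, Real.rpow_zero, mul_one]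
  have hAP : A * P = A := by
    rw [← sub_eq_zero, ← neg_eq_zero, neg_sub]
    have h2 : A - A * P = A * (1 - P) := by rw [Matrix.mul_sub, Matrix.mul_one]
    rw [h2]
    refine Matrix.ext_of_mulVec_single fun i => ?_
    rw [← mulVec_mulVec, zero_mulVec]
    -- The range of `1 - P` lies in `ker B`, hence in `ker A`.
    have h3 : (1 - P) *ᵥ Pi.single i 1 ∈ LinearMap.ker B.mulVecLin := by
      rw [LinearMap.mem_ker, mulVecLin_apply, mulVec_mulVec, Matrix.mul_sub, Matrix.mul_one, hBP,
        sub_self, zero_mulVec]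
    simpa using h h3
  have hPA : P * A = A := by
    have h4 := congrArg conjTranspose hAP
    rw [conjTranspose_mul, hA.eq] at h4
    rwa [hP, conjTranspose_mul, (isHermitian_matrixPower B s).eq,
      (isHermitian_matrixPower B (-s)).eq, hPP] at h4
  calc _ = (matrixPower B s * matrixPower B (-s)) * A * P := by
        rw [hP]; simp only [Matrix.mul_assoc]
    _ = A := by rw [hPP, hPA, hAP]

theorem sandwich_posSemidef {A : Matrix H H ℂ} (hA : A.PosSemidef) (B : Matrix H H ℂ) (s : ℝ) :
    (matrixPower B s * A * matrixPower B s).PosSemidef := by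
  have := hA.mul_mul_conjTranspose_same (matrixPower B s)
  rwa [(isHermitian_matrixPower B s).eq] at this

/-- Data processing of the sandwiched quasi-entropy under a two-outcome test. -/
theorem trace_test_le {A B Λ : Matrix H H ℂ} (hA : A.PosSemidef) (hB : B.PosSemidef)
    (hΛ : Λ.PosSemidef) (hΛ1 : (1 - Λ).PosSemidef)
    (h : LinearMap.ker B.mulVecLin ≤ LinearMap.ker A.mulVecLin) {α : ℝ} (hα : 1 < α) :
    (Λ * A).trace.re ≤ (Λ * B).trace.re ^ ((α - 1) / α) *
      (matrixPower (matrixPower B ((1 - α) / (2 * α)) * A *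
        matrixPower B ((1 - α) / (2 * α))) α).trace.re ^ (1 / α) := by
  have hα0 : 0 < α := by linarith
  set s : ℝ := (α - 1) / (2 * α) with hs
  have hs0 : 0 < s := by rw [hs]; apply div_pos <;> linarith
  have hns : (1 - α) / (2 * α) = -s := by rw [hs]; ring
  rw [hns]
  set S := matrixPower B s with hS
  set X := matrixPower B (-s) * A * matrixPower B (-s) with hX
  have hXpos : X.PosSemidef := sandwich_posSemidef hA B (-s)
  have hSX : S * X * S = A := matrixPower_conj_conj hA.1 hB h s
  set T := matrixPower Λ (1 / 2) with hT
  have hTT : T * T = Λ := by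
    rw [hT, matrixPower_mul hΛ (by norm_num)]
    norm_num
    exact matrixPower_one hΛ.1
  have hTH : Tᴴ = T := isHermitian_matrixPower Λ _
  have hpq : (α / (α - 1)).HolderConjugate α :=
    (Real.HolderConjugate.conjExponent hα).symm
  have h1 : (Λ * A).trace = (S * Λ * S * X).trace := by
    rw [← hSX, trace_mul_comm]
    rw [show S * X * S * Λ = S * (X * S * Λ) by simp only [Matrix.mul_assoc], trace_mul_comm,
      show X * S * Λ * S = X * (S * Λ * S) by simp only [Matrix.mul_assoc], trace_mul_comm]
  have hSΛ : (S * Λ * S).PosSemidef := sandwich_posSemidef hΛ B s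
  have hq1 : 1 ≤ α / (α - 1) := hpq.lt.le
  have h2 : (matrixPower (S * Λ * S) (α / (α - 1))).trace.re ≤ (Λ * B).trace.re := by
    -- `(ST)(TS)` and `(TS)(ST)` have the same eigenvalues, and the second is `B^((α-1)/α)`
    -- conjugated by the contraction `T`. Jensen with the exponent `α/(α-1)` turns this power back
    -- into `B`.
    have e1 : S * Λ * S = (S * T) * (T * S) := by rw [← hTT]; simp only [Matrix.mul_assoc]
    have hSS : S * S = matrixPower B (s + s) := by rw [hS, matrixPower_mul hB (by linarith)]
    have e2 : (T * S) * (S * T) = T * matrixPower B (s + s) * Tᴴ := by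
      rw [← hSS, hTH]; simp only [Matrix.mul_assoc]
    have hp2 := (matrixPower_posSemidef hB (s + s)).mul_mul_conjTranspose_same T
    rw [e1, trace_matrixPower_mul_comm (e1 ▸ hSΛ.1) (e2 ▸ hp2.1), e2]
    refine (trace_matrixPower_conj_le (matrixPower_posSemidef hB _) hq1 T
      (by rwa [hTH, hTT])).trans ?_
    have e3 : (s + s) * (α / (α - 1)) = 1 := by
      have : α - 1 ≠ 0 := by linarith
      rw [hs]; field_simp; ring
    rw [matrixPower_matrixPower hB, e3, matrixPower_one hB.1, hTH, trace_mul_cycle, hTT]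
  rw [h1]
  refine (trace_mul_le_holder hSΛ hXpos hpq).trans ?_
  rw [one_div_div]
  have h3 : 0 ≤ (matrixPower (S * Λ * S) (α / (α - 1))).trace.re :=
    (Complex.le_def.1 (matrixPower_posSemidef hSΛ _).trace_nonneg).1
  have h4 : 0 ≤ (matrixPower X α).trace.re :=
    (Complex.le_def.1 (matrixPower_posSemidef hXpos _).trace_nonneg).1
  have h5 : 0 ≤ (α - 1) / α := div_nonneg (by linarith) hα0.le
  gcongr

/-- A bound on the sandwiched quasi-entropy of a dominated operator. -/
theorem trace_sandwich_le_of_le {A B : Matrix H H ℂ} (hA : A.PosSemidef) (hB : B.PosSemidef)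
    {c : ℝ} (hc : 0 ≤ c) (h : (c • B - A).PosSemidef) {α : ℝ} (hα : 1 < α) :
    (matrixPower (matrixPower B ((1 - α) / (2 * α)) * A *
        matrixPower B ((1 - α) / (2 * α))) α).trace.re ≤ c ^ α * B.trace.re := by
  have hα0 : 0 < α := by linarith
  set t : ℝ := (1 - α) / (2 * α) with ht
  set S := matrixPower B t with hS
  have hSBS : S * B * S = matrixPower B (1 / α) := by
    have e1 : t + 1 ≠ 0 := by
      have : t + 1 = (1 + α) / (2 * α) := by rw [ht]; field_simp; ring
      rw [this]; positivity
    have e2 : t + 1 + t = 1 / α := by rw [ht]; field_simp; ring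
    have e3 : t + 1 + t ≠ 0 := by rw [e2]; positivity
    conv_lhs => enter [1, 2]; rw [← matrixPower_one hB.1]
    rw [hS, matrixPower_mul hB e1, matrixPower_mul hB e3, e2]
  have hX : (S * A * S).PosSemidef := sandwich_posSemidef hA B t
  set U : Matrix H H ℂ := ↑hX.1.eigenvectorUnitary with hU
  -- The map `x ↦ x ^ α` is not operator monotone for `α > 1`, so the comparison is made on diagonal
  -- entries in an eigenbasis of `S A S`, with Peierls closing the gap.
  have hle : ∀ j, hX.1.eigenvalues j ≤ c * ((Uᴴ * matrixPower B (1 / α) * U) j j).re := by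
    intro j
    have h1 := ((sandwich_posSemidef h B t).conjTranspose_mul_mul_same U).re_apply_diag_nonneg j
    rw [Matrix.mul_sub, Matrix.sub_mul, Matrix.mul_smul, Matrix.smul_mul, hSBS, Matrix.mul_sub,
      Matrix.sub_mul, Matrix.mul_smul, Matrix.smul_mul, Matrix.sub_apply, Matrix.smul_apply, Complex.sub_re,
      Complex.real_smul, Complex.re_ofReal_mul, hU, hX.1.conj_eigenvectorUnitary_apply j] at h1
    linarith
  rw [matrixPower, hX.1.trace_cfc, Complex.ofReal_re,
    ← trace_conj_eigenvectorUnitary hX.1 B, trace, Complex.re_sum, Finset.mul_sum]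
  refine Finset.sum_le_sum fun j _ => ?_
  have hz : 0 ≤ ((Uᴴ * matrixPower B (1 / α) * U) j j).re :=
    ((matrixPower_posSemidef hB _).conjTranspose_mul_mul_same U).re_apply_diag_nonneg j
  refine (Real.rpow_le_rpow (hX.eigenvalues_nonneg j) (hle j) hα0.le).trans ?_
  rw [Real.mul_rpow hc hz]
  refine mul_le_mul_of_nonneg_left ?_ (Real.rpow_nonneg hc _)
  have h2 := rpow_conj_apply_le (matrixPower_posSemidef hB (1 / α)) hα.le U j (by
    rw [hU, eigenvectorUnitary_conjTranspose_mul]; simp)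
  rwa [matrixPower_matrixPower hB, one_div_mul_cancel hα0.ne', matrixPower_one hB.1] at h2

end MatrixInequalities

/-! ### Tensor powers of channels preserve density operators. -/

section TensorPower

/-- Schur product theorem, by induction from the all-ones matrix. With `J` the Choi matrix of `N` it
yields that of `N^{⊗n}`. -/
theorem posSemidef_prod_submatrix {ι H K : Type*} [Finite H] [Fintype K]
    {J : Matrix K K ℂ} (hJ : J.PosSemidef) (f : ι → H → K) (s : Finset ι) :
    (Matrix.of fun u v : H => ∏ i ∈ s, J (f i u) (f i v)).PosSemidef := by
  classical
  have := Fintype.ofFinite H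
  induction s using Finset.induction_on with
  | empty =>
    have h := posSemidef_vecMulVec_self_star (fun _ : H => (1 : ℂ))
    have e : (Matrix.of fun u v : H => ∏ i ∈ (∅ : Finset ι), J (f i u) (f i v)) =
        vecMulVec (fun _ : H => (1 : ℂ)) (star fun _ : H => (1 : ℂ)) := by
      ext u v
      simp [vecMulVec]
    rwa [e]
  | insert i s hi ih =>
    have h := (hJ.submatrix (f i)).hadamard ih
    have e : (Matrix.of fun u v : H => ∏ j ∈ insert i s, J (f j u) (f j v)) =
        J.submatrix (f i) (f i) ⊙ of fun u v => ∏ j ∈ s, J (f j u) (f j v) := by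
      ext u v
      simp [Finset.prod_insert hi]
    rwa [e]

variable {A B : Type*} [Fintype A] [DecidableEq A] [Fintype B]

/-- The Choi matrix of a completely positive map is positive semidefinite. -/
theorem IsCompletelyPositive.choi_posSemidef {B : Type*} {N : Matrix A A ℂ →ₗ[ℂ] Matrix B B ℂ}
    (hN : IsCompletelyPositive N) :
    (Matrix.of fun u v : A × B => N (Matrix.single u.1 v.1 1) u.2 v.2).PosSemidef := by
  set e := Fintype.equivFin A
  -- The input is the unnormalised maximally entangled vector on two copies of `A`.
  have h := hN (Fintype.card A) _ (posSemidef_vecMulVec_self_star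
    (fun u : Fin (Fintype.card A) × A => if e.symm u.1 = u.2 then (1 : ℂ) else 0))
  have h2 := h.submatrix (fun u : A × B => (e u.1, u.2))
  refine (congrArg PosSemidef ?_).mp h2
  ext u v
  simp only [idTensor, of_apply, submatrix_apply]
  refine congrArg (fun Y => N Y u.2 v.2) ?_
  ext a a'
  simp [vecMulVec, Matrix.single_apply, ite_and]
  split_ifs <;> rfl

/-- `N^{⊗n}(X)` is the entrywise product of `X` with the Choi matrix, summed over the input indices.
That sum is a congruence by a 0-1 matrix. -/
theorem tensorPower_posSemidef [DecidableEq B] {N : Matrix A A ℂ →ₗ[ℂ] Matrix B B ℂ}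
    (hN : IsCompletelyPositive N) (n : ℕ) {X : Matrix (Fin n → A) (Fin n → A) ℂ}
    (hX : X.PosSemidef) : (tensorPower N n X).PosSemidef := by
  have h1 := posSemidef_prod_submatrix hN.choi_posSemidef
    (fun (i : Fin n) (u : (Fin n → A) × (Fin n → B)) => (u.1 i, u.2 i)) Finset.univ
  have h2 := (hX.submatrix (fun u : (Fin n → A) × (Fin n → B) => u.1)).hadamard h1
  have h3 := h2.conjTranspose_mul_mul_same
    (Matrix.of fun (u : (Fin n → A) × (Fin n → B)) b => if u.2 = b then (1 : ℂ) else 0)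
  refine (congrArg PosSemidef ?_).mp h3
  ext b b'
  simp only [tensorPower, LinearMap.coe_mk, AddHom.coe_mk, of_apply, mul_apply,
    conjTranspose_apply, Fintype.sum_prod_type, hadamard_apply, submatrix_apply]
  simp [apply_ite]
  rw [Finset.sum_comm]

theorem trace_tensorPower {N : Matrix A A ℂ →ₗ[ℂ] Matrix B B ℂ}
    (hN : ∀ X, (N X).trace = X.trace) (n : ℕ) (X : Matrix (Fin n → A) (Fin n → A) ℂ) :
    (tensorPower N n X).trace = X.trace := by
  have h : ∀ a a' : Fin n → A, ∑ b : Fin n → B, ∏ i, N (Matrix.single (a i) (a' i) 1) (b i) (b i) =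
      if a = a' then 1 else 0 := by
    intro a a'
    have := Finset.prod_univ_sum (fun _ : Fin n => (Finset.univ : Finset B))
      (fun i b => N (Matrix.single (a i) (a' i) 1) b b)
    rw [Fintype.piFinset_univ] at this
    rw [← this]
    have h2 : ∀ i, ∑ b, N (Matrix.single (a i) (a' i) 1) b b = if a i = a' i then 1 else 0 := by
      intro i
      have := hN (Matrix.single (a i) (a' i) 1)
      rw [trace] at this
      simp only [diag_apply] at this
      rw [this]
      split_ifs with hi
      · rw [hi, trace_single_eq_same]
      · rw [trace_single_eq_of_ne _ _ _ hi]
    simp only [h2]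
    rw [Finset.prod_ite_zero]
    simp [funext_iff]
  simp only [trace, diag_apply, tensorPower, LinearMap.coe_mk, AddHom.coe_mk, of_apply]
  rw [Finset.sum_comm]
  refine Finset.sum_congr rfl fun a _ => ?_
  rw [Finset.sum_comm]
  simp only [← Finset.mul_sum, h]
  simp

theorem IsQuantumChannel.tensorPower_isDensity [DecidableEq B]
    {N : Matrix A A ℂ →ₗ[ℂ] Matrix B B ℂ} (hN : IsQuantumChannel N) (n : ℕ)
    {X : Matrix (Fin n → A) (Fin n → A) ℂ} (hX : IsDensity X) : IsDensity (tensorPower N n X) :=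
  ⟨tensorPower_posSemidef hN.completelyPositive n hX.1,
    (trace_tensorPower hN.tracePreserving n X).trans hX.2⟩

end TensorPower

/-! ### Block-diagonal classical-quantum operators. -/

section ClassicalQuantum

variable {X Q : Type*} [Fintype X] [DecidableEq X]

theorem cqState_apply (p : X → ℝ) (ρ : X → Matrix Q Q ℂ) (u v : X × Q) :
    cqState p ρ u v = if u.1 = v.1 then (p u.1 : ℂ) * ρ u.1 u.2 v.2 else 0 := by
  rw [cqState, Matrix.sum_apply, Finset.sum_eq_single u.1]
  · simp [Matrix.kroneckerMap_apply, Matrix.single_apply]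
  · intro x _ hx
    simp [Matrix.kroneckerMap_apply, hx]
  · simp

variable [Fintype Q]

theorem cqState_posSemidef {p : X → ℝ} (hp : ∀ x, 0 ≤ p x) {ρ : X → Matrix Q Q ℂ}
    (hρ : ∀ x, (ρ x).PosSemidef) : (cqState p ρ).PosSemidef := by
  refine posSemidef_sum _ fun x _ => PosSemidef.smul (PosSemidef.kronecker ?_ (hρ x)) ?_
  · rw [← Matrix.diagonal_single]
    refine PosSemidef.diagonal fun i => ?_
    by_cases h : i = x
    · simp [h]
    · simp [h]
  · exact_mod_cast hp x

/-- Puts the reference operator `ρ_X ⊗ σ` in the same block-diagonal form as `ρ_{XQ}`. -/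
theorem partialTraceRight_cqState_kronecker (p : X → ℝ) {ρ : X → Matrix Q Q ℂ}
    (hρ : ∀ x, (ρ x).trace = 1) (σ : Matrix Q Q ℂ) :
    partialTraceRight (cqState p ρ) ⊗ₖ σ = cqState p fun _ => σ := by
  ext u v
  rw [kroneckerMap_apply, cqState_apply, partialTraceRight, of_apply]
  simp only [cqState_apply]
  split_ifs with h
  · have := hρ u.1
    rw [trace] at this
    simp only [diag_apply] at this
    rw [← Finset.mul_sum, this, mul_one]
  · simp

/-- With unit weights `cqState` is the direct sum `⊕ₓ Λₓ`, the test associated with a decoder. -/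
theorem trace_cqState_mul (p : X → ℝ) (Λ ρ : X → Matrix Q Q ℂ) :
    (cqState (fun _ => 1) Λ * cqState p ρ).trace.re = ∑ x, p x * (Λ x * ρ x).trace.re := by
  simp only [trace, diag_apply, mul_apply, cqState_apply, Fintype.sum_prod_type, Complex.re_sum]
  refine Finset.sum_congr rfl fun x _ => ?_
  rw [Finset.mul_sum]
  refine Finset.sum_congr rfl fun q _ => ?_
  rw [Finset.sum_eq_single x]
  · rw [Finset.mul_sum]
    refine Finset.sum_congr rfl fun q' _ => ?_
    rw [if_pos rfl, if_pos rfl, ← Complex.re_ofReal_mul]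
    congr 1
    push_cast
    ring
  · intro y _ hy
    simp [hy.symm]
  · simp

end ClassicalQuantum

/-! ### Lower and upper bounds on the sandwiched Rényi relative entropy. -/

section SandwichedRenyi

variable {H : Type*} [Fintype H] [DecidableEq H]

theorem Matrix.PosSemidef.re_trace_nonneg {H : Type*} [Fintype H] {A : Matrix H H ℂ} (hA : A.PosSemidef) :
    0 ≤ A.trace.re :=
  (Complex.le_def.1 hA.trace_nonneg).1

theorem trace_mul_re_nonneg {A B : Matrix H H ℂ} (hA : A.PosSemidef) (hB : B.PosSemidef) :
    0 ≤ (A * B).trace.re := by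
  have e : A = matrixPower A (1 / 2) * matrixPower A (1 / 2) := by
    rw [matrixPower_mul hA (by norm_num), add_halves, matrixPower_one hA.1]
  rw [e, trace_mul_cycle, trace_mul_cycle]
  exact (sandwich_posSemidef hB A _).re_trace_nonneg

/-- A two-outcome test bounds the sandwiched Rényi relative entropy from below. -/
theorem le_sandwichedRenyi_of_test {A B Λ : Matrix H H ℂ} (hA : A.PosSemidef)
    (hB : B.PosSemidef) (hΛ : Λ.PosSemidef) (hΛ1 : (1 - Λ).PosSemidef) {α : ℝ} (hα : 1 < α)
    (hpos : 0 < (Λ * A).trace.re) :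
    (((α * Real.log (Λ * A).trace.re - (α - 1) * Real.log (Λ * B).trace.re) /
      ((α - 1) * Real.log 2) : ℝ) : EReal) ≤ sandwichedRenyi α A B := by
  have hα1 : 0 < α - 1 := by linarith
  have hα0 : 0 < α := by linarith
  have hl : 0 < Real.log 2 := Real.log_pos (by norm_num)
  have hc : 0 < 1 / (α - 1) / Real.log 2 := by positivity
  rw [sandwichedRenyi, sandwichedQuasiEntropy]
  split_ifs with h
  · have key := trace_test_le hA hB hΛ hΛ1 h hα
    set S := (matrixPower (matrixPower B ((1 - α) / (2 * α)) * A *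
        matrixPower B ((1 - α) / (2 * α))) α).trace.re with hS
    set t := (Λ * B).trace.re with ht
    have hS0 : 0 ≤ S := (matrixPower_posSemidef (sandwich_posSemidef hA _ _) _).re_trace_nonneg
    have ht0 : 0 ≤ t := trace_mul_re_nonneg hΛ hB
    have hprod := hpos.trans_le key
    -- The product bounds a positive number, so neither factor vanishes and logarithms may be taken.
    have hS1 : 0 < S := by
      refine hS0.lt_of_ne fun h0 => ?_
      rw [← h0, Real.zero_rpow (by positivity), mul_zero] at hprod
      exact hprod.false
    have ht1 : 0 < t := by
      refine ht0.lt_of_ne fun h0 => ?_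
      rw [← h0, Real.zero_rpow (by positivity), zero_mul] at hprod
      exact hprod.false
    have hlog := Real.log_le_log hpos key
    rw [Real.log_mul (by positivity) (by positivity), Real.log_rpow ht1, Real.log_rpow hS1] at hlog
    rw [ENNReal.log_ofReal_of_pos hS1, ← EReal.coe_mul, EReal.coe_le_coe_iff]
    have e : 1 / (α - 1) / Real.log 2 * Real.log S = Real.log S / ((α - 1) * Real.log 2) := by
      field_simp
    rw [e]
    refine div_le_div_of_nonneg_right ?_ (by positivity)
    have h2 := mul_le_mul_of_nonneg_left hlog hα0.le
    have e2 : α * ((α - 1) / α * Real.log t + 1 / α * Real.log S) =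
        (α - 1) * Real.log t + Real.log S := by field_simp
    linarith
  · rw [ENNReal.log_top, EReal.coe_mul_top_of_pos hc]
    exact le_top

/-- The max-relative entropy bounds the sandwiched Rényi relative entropy from above. -/
theorem sandwichedRenyi_le_of_le {A B : Matrix H H ℂ} (hA : A.PosSemidef) (hB : B.PosSemidef)
    (hB1 : B.trace.re = 1) {c : ℝ} (hc : 0 < c) (h : (c • B - A).PosSemidef) {α : ℝ}
    (hα : 1 < α) :
    sandwichedRenyi α A B ≤ ((1 / (α - 1) / Real.log 2 * (α * Real.log c) : ℝ) : EReal) := by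
  have hα1 : 0 < α - 1 := by linarith
  have hl : 0 < Real.log 2 := Real.log_pos (by norm_num)
  -- If `Bv = 0` then `0 ≤ ⟨v, Av⟩ ≤ c ⟨v, Bv⟩ = 0`, and positivity of `A` gives `Av = 0`.
  have hk : LinearMap.ker B.mulVecLin ≤ LinearMap.ker A.mulVecLin := by
    intro v hv
    rw [LinearMap.mem_ker, mulVecLin_apply] at hv ⊢
    have h1 := h.dotProduct_mulVec_nonneg v
    rw [sub_mulVec, smul_mulVec, hv, smul_zero, zero_sub, dotProduct_neg, neg_nonneg] at h1
    exact (hA.dotProduct_mulVec_zero_iff v).1 (le_antisymm h1 (hA.dotProduct_mulVec_nonneg v))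
  have key := trace_sandwich_le_of_le hA hB hc.le h hα
  rw [hB1, mul_one] at key
  rw [sandwichedRenyi, sandwichedQuasiEntropy, if_pos hk, EReal.coe_mul, ← Real.log_rpow hc,
    ← ENNReal.log_ofReal_of_pos (Real.rpow_pos_of_pos hc α)]
  exact mul_le_mul_of_nonneg_left (ENNReal.log_monotone (ENNReal.ofReal_le_ofReal key))
    (EReal.coe_nonneg.2 (by positivity))

theorem IsDensity.one_sub_posSemidef {ρ : Matrix H H ℂ} (hρ : IsDensity ρ) :
    (1 - ρ).PosSemidef := by
  obtain ⟨hp, ht⟩ := hρ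
  have hle : ∀ i, hp.1.eigenvalues i ≤ 1 := by
    intro i
    have h := hp.1.trace_cfc (fun x => x)
    rw [cfc_id' ℝ ρ hp.1.isSelfAdjoint] at h
    have h1 : (1 : ℝ) = ∑ i, hp.1.eigenvalues i := by exact_mod_cast ht.symm.trans h
    rw [h1]
    exact Finset.single_le_sum (f := hp.1.eigenvalues)
      (fun j _ => hp.eigenvalues_nonneg j) (Finset.mem_univ i)
  have e : 1 - ρ = cfc (fun x : ℝ => 1 - x) ρ := by
    rw [cfc_sub _ _ _ (continuousOn_spectrum_real ρ _) (continuousOn_spectrum_real ρ _),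
      cfc_id' ℝ ρ hp.1.isSelfAdjoint, cfc_const_one ℝ ρ hp.1.isSelfAdjoint]
  rw [e, hp.1.cfc_eq_mul_diagonal_mul]
  refine PosSemidef.mul_mul_conjTranspose_same (PosSemidef.diagonal fun i => ?_) _
  have := sub_nonneg.2 (hle i)
  exact Complex.zero_le_real.2 this

theorem IsDensity.nonempty {H : Type*} [Fintype H] {ρ : Matrix H H ℂ} (hρ : IsDensity ρ) : Nonempty H := by
  by_contra h
  rw [not_nonempty_iff] at h
  have := hρ.2
  simp [trace] at this

theorem isDensity_maximallyMixed [Nonempty H] :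
    IsDensity ((Fintype.card H : ℝ)⁻¹ • (1 : Matrix H H ℂ)) := by
  refine ⟨PosSemidef.one.smul (by positivity), ?_⟩
  simp [trace_smul]

end SandwichedRenyi

/-! ### The `α`-Holevo information of an ensemble. -/

section Holevo

variable {X Q : Type*} [Fintype X] [DecidableEq X] [Fintype Q] [DecidableEq Q]

/-- The success probability of state discrimination bounds the `α`-Holevo information of an
ensemble from below. -/
theorem le_ensembleAlphaHolevo {p : X → ℝ} (hp : ∀ x, 0 ≤ p x) {ρ : X → Matrix Q Q ℂ}
    (hρ : ∀ x, IsDensity (ρ x)) {Λ : X → Matrix Q Q ℂ} (hΛ : ∀ x, (Λ x).PosSemidef)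
    (hΛ1 : ∀ x, (1 - Λ x).PosSemidef) {t : ℝ}
    (ht : ∀ σ, IsDensity σ → ∑ x, p x * (Λ x * σ).trace.re = t) {α : ℝ} (hα : 1 < α)
    (hpos : 0 < ∑ x, p x * (Λ x * ρ x).trace.re) :
    (((α * Real.log (∑ x, p x * (Λ x * ρ x).trace.re) - (α - 1) * Real.log t) /
      ((α - 1) * Real.log 2) : ℝ) : EReal) ≤ ensembleAlphaHolevo α p ρ := by
  refine le_iInf fun ⟨σ, hσ⟩ => ?_
  rw [partialTraceRight_cqState_kronecker p (fun x => (hρ x).2)]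
  have e1 := trace_cqState_mul p Λ ρ
  have e2 := trace_cqState_mul p Λ fun _ => σ
  -- The acceptance probability `t` is the same for every `σ`, so one bound serves the whole
  -- infimum.
  rw [ht σ hσ] at e2
  have e3 : 1 - cqState (fun _ => 1) Λ = cqState (fun _ => 1) fun x => 1 - Λ x := by
    ext u v
    simp only [Matrix.sub_apply, cqState_apply, Matrix.one_apply, Prod.ext_iff]
    split_ifs <;> simp_all
  rw [← e1, ← e2]
  refine le_sandwichedRenyi_of_test (cqState_posSemidef hp fun x => (hρ x).1)
    (cqState_posSemidef hp fun _ => hσ.1) (cqState_posSemidef (fun _ => zero_le_one) hΛ)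
    (by rw [e3]; exact cqState_posSemidef (fun _ => zero_le_one) hΛ1) hα (by rwa [e1])

/-- For `σ = 1/d` with `d = card Q`, each `ρₓ ≤ 1 = d σ`, so `ρ_{XQ} ≤ d (ρ_X ⊗ σ)`. The bound does
not depend on the ensemble, as the supremum requires. -/
theorem ensembleAlphaHolevo_le [Nonempty Q] {p : X → ℝ} (hp : ∀ x, 0 ≤ p x)
    (hp1 : ∑ x, p x = 1) {ρ : X → Matrix Q Q ℂ} (hρ : ∀ x, IsDensity (ρ x)) {α : ℝ}
    (hα : 1 < α) :
    ensembleAlphaHolevo α p ρ ≤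
      ((1 / (α - 1) / Real.log 2 * (α * Real.log (Fintype.card Q)) : ℝ) : EReal) := by
  refine iInf_le_of_le ⟨_, isDensity_maximallyMixed⟩ ?_
  rw [partialTraceRight_cqState_kronecker p (fun x => (hρ x).2)]
  have hd : (Fintype.card Q : ℂ) ≠ 0 := by simp
  refine sandwichedRenyi_le_of_le (cqState_posSemidef hp fun x => (hρ x).1)
    (cqState_posSemidef hp fun _ => isDensity_maximallyMixed.1) ?_ (by positivity) ?_ hα
  · have h := trace_cqState_mul p (fun _ => 1)
      (fun _ => (Fintype.card Q : ℝ)⁻¹ • (1 : Matrix Q Q ℂ))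
    have e : cqState (fun _ : X => 1) (fun _ => (1 : Matrix Q Q ℂ)) = 1 := by
      ext u v
      simp only [cqState_apply, Matrix.one_apply, Prod.ext_iff]
      split_ifs <;> simp_all
    simp only [e, Matrix.one_mul, isDensity_maximallyMixed.2, Complex.one_re, mul_one, hp1] at h
    exact h
  · have e : (Fintype.card Q : ℝ) •
        cqState p (fun _ => (Fintype.card Q : ℝ)⁻¹ • (1 : Matrix Q Q ℂ)) - cqState p ρ =
        cqState p fun x => 1 - ρ x := by
      ext u v
      simp only [Matrix.sub_apply, Matrix.smul_apply, cqState_apply, Complex.real_smul]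
      split_ifs
      · push_cast
        field_simp
      · simp
    rw [e]
    exact cqState_posSemidef hp fun x => (hρ x).one_sub_posSemidef

end Holevo

/-! ### The `α`-Holevo information of a channel and the one-shot converse. -/

section Channel

variable {A B : Type*} [Fintype A] [Fintype B] [DecidableEq B]

theorem alphaHolevo_ne_top [Nonempty B] {N : Matrix A A ℂ →ₗ[ℂ] Matrix B B ℂ}
    (hN : ∀ ρ, IsDensity ρ → IsDensity (N ρ)) {α : ℝ} (hα : 1 < α) : alphaHolevo α N ≠ ⊤ :=
  ((iSup₂_le fun _ E => ensembleAlphaHolevo_le E.prob_nonneg E.prob_sum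
    (fun x => hN _ (E.state_density x)) hα).trans_lt (EReal.coe_lt_top _)).ne

theorem alphaHolevo_ne_bot {N : Matrix A A ℂ →ₗ[ℂ] Matrix B B ℂ}
    (hN : ∀ ρ, IsDensity ρ → IsDensity (N ρ)) {ρ : Matrix A A ℂ} (hρ : IsDensity ρ) {α : ℝ}
    (hα : 1 < α) : alphaHolevo α N ≠ ⊥ := by
  let E : Ensemble A 1 := ⟨fun _ => 1, fun _ => zero_le_one, by simp, fun _ => ρ, fun _ => hρ⟩
  -- The trivial test accepts both states with probability one, so the lower bound is the real
  -- number `0`.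
  have h : _ ≤ ensembleAlphaHolevo α E.prob fun x => N (E.state x) :=
    le_ensembleAlphaHolevo (Λ := fun _ => 1) (t := 1) E.prob_nonneg
      (fun x => hN _ (E.state_density x)) (fun _ => PosSemidef.one)
      (fun _ => by rw [sub_self]; exact PosSemidef.zero)
      (fun σ hσ => by simp [E, hσ.2]) hα (by simp [E, (hN _ hρ).2])
  exact ((EReal.bot_lt_coe _).trans_le (h.trans (le_iSup₂_of_le 1 E le_rfl))).ne'

/-- The one-shot converse: the success probability `P` of a code with message set `M` satisfies
`α log P + (α - 1) log |M| ≤ (α - 1) χ̃_α`. -/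
theorem le_alphaHolevo_of_code {M : Type*} [Fintype M] [Nonempty M]
    {N : Matrix A A ℂ →ₗ[ℂ] Matrix B B ℂ} (hN : ∀ ρ, IsDensity ρ → IsDensity (N ρ))
    {ρ : M → Matrix A A ℂ} (hρ : ∀ m, IsDensity (ρ m)) {Λ : M → Matrix B B ℂ}
    (hΛ : ∀ m, (Λ m).PosSemidef) (hΛ1 : ∑ m, Λ m = 1) {α : ℝ} (hα : 1 < α) {P : ℝ}
    (hP : P = 1 / (Fintype.card M : ℝ) * ∑ m, (Λ m * N (ρ m)).trace.re) (hP0 : 0 < P) :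
    (((α * Real.log P + (α - 1) * Real.log (Fintype.card M)) / ((α - 1) * Real.log 2) : ℝ) :
      EReal) ≤ alphaHolevo α N := by
  classical
  set k := Fintype.card M with hk
  have hk0 : (k : ℝ) ≠ 0 := by simp [hk]
  let e : Fin k ≃ M := (Fintype.equivFin M).symm
  -- The uniform ensemble of codewords, with messages relabelled by `Fin k`.
  let E : Ensemble A k := ⟨fun _ => 1 / (k : ℝ), fun _ => by positivity, by simp [hk0],
    fun x => ρ (e x), fun x => hρ _⟩
  have hsum : ∀ f : M → ℝ, ∑ x, E.prob x * f (e x) = 1 / (k : ℝ) * ∑ m, f m := by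
    intro f
    rw [← Finset.mul_sum, e.sum_comp]
  have hP' : ∑ x, E.prob x * (Λ (e x) * N (E.state x)).trace.re = P := by
    rw [hP]
    exact hsum fun m => (Λ m * N (ρ m)).trace.re
  have hsub : ∀ m, (1 - Λ m).PosSemidef := by
    intro m
    rw [← hΛ1, ← Finset.sum_erase_eq_sub (Finset.mem_univ m)]
    exact posSemidef_sum _ fun i _ => hΛ i
  have h : _ ≤ ensembleAlphaHolevo α E.prob fun x => N (E.state x) :=
    le_ensembleAlphaHolevo (Λ := fun x => Λ (e x)) (t := 1 / (k : ℝ)) E.prob_nonneg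
      (fun x => hN _ (E.state_density x)) (fun x => hΛ _) (fun x => hsub _)
      -- Guessing without information: `(1/k) ∑ₘ Tr Λₘ σ = (1/k) Tr σ = 1/k`.
      (fun σ hσ => by
        rw [hsum fun m => (Λ m * σ).trace.re, ← Complex.re_sum, ← trace_sum, ← Finset.sum_mul,
          hΛ1, Matrix.one_mul, hσ.2, Complex.one_re, mul_one]) hα (by rwa [hP'])
  rw [hP', one_div, Real.log_inv, mul_neg, sub_neg_eq_add] at h
  exact h.trans (le_iSup₂_of_le k E le_rfl)

end Channel

/-! ### The strong converse bound. -/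

theorem mainTheorem8 {A B M : Type*} [Fintype A] [DecidableEq A] [Fintype B] [DecidableEq B]
    [Fintype M] (N : Matrix A A ℂ →ₗ[ℂ] Matrix B B ℂ) (hN : IsQuantumChannel N)
    (α : ℝ) (hα : α ∈ Set.Ioc (1 : ℝ) 2) (n : ℕ) (hn : 0 < n) (R : ℝ)
    (C : ClassicalCode A B M n) (hR : C.HasRate R) :
    ∃ χ : ℝ, alphaHolevo α (tensorPower N n) = (χ : EReal) ∧
      C.successProb N ≤ (2 : ℝ) ^ (-(n : ℝ) * ((α - 1) / α) * (R - 1 / (n : ℝ) * χ)) := by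
  have hα1 : 0 < α - 1 := by linarith [hα.1]
  have hα0 : 0 < α := by linarith
  have hl : 0 < Real.log 2 := Real.log_pos (by norm_num)
  have hT : ∀ ρ, IsDensity ρ → IsDensity (tensorPower N n ρ) :=
    fun ρ hρ => hN.tensorPower_isDensity n hρ
  -- A power of two is positive, so there is a message. Its codeword supplies an input state, and
  -- its output state shows that the output space is nonzero.
  have hM : 0 < (Fintype.card M : ℝ) := by
    rw [hR]
    positivity
  have hne : Nonempty M := Fintype.card_pos_iff.1 (by exact_mod_cast hM)
  have m : M := Classical.arbitrary M
  have := (hT _ (C.codeword_density m)).nonempty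
  have htop := alphaHolevo_ne_top hT hα.1
  have hbot := alphaHolevo_ne_bot hT (C.codeword_density m) hα.1
  refine ⟨(alphaHolevo α (tensorPower N n)).toReal, (EReal.coe_toReal htop hbot).symm, ?_⟩
  set χ := (alphaHolevo α (tensorPower N n)).toReal with hχ
  -- Logarithms need a positive success probability; otherwise the bound is trivial.
  rcases le_or_gt (C.successProb N) 0 with h0 | h0
  · exact h0.trans (by positivity)
  have key := le_alphaHolevo_of_code hT C.codeword_density C.povm_pos C.povm_sum hα.1
    (P := C.successProb N) rfl h0
  rw [← EReal.coe_toReal htop hbot, EReal.coe_le_coe_iff, ← hχ, div_le_iff₀ (by positivity), hR,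
    Real.log_rpow two_pos] at key
  rw [← Real.log_le_log_iff h0 (by positivity), Real.log_rpow two_pos]
  have hn0 : (n : ℝ) ≠ 0 := by positivity
  have e : -(n : ℝ) * ((α - 1) / α) * (R - 1 / (n : ℝ) * χ) * Real.log 2 =
      (χ * ((α - 1) * Real.log 2) - (α - 1) * (n * R * Real.log 2)) / α := by
    field_simp
    ring
  rw [e, le_div_iff₀ hα0]
  linarith
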